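/- Let $p$ be a prime, let $q$ be a power of $p$ (with positive exponent), and let $k,t\ge 1$ and $r\ge 0$ be integers. Put $q'=p^r$, $p_i=1+q'+q'^2+\cdots+q'^i$ for $0\le i\le k$, and $n=t\,p_k$. Let $s$ be a positive integer with $\gcd(s,n)=1$ and let $\sigma\colon x\in\mathbb F_{q^n}\mapsto x^{q^s}\in\mathbb F_{q^n}$, so that $x^{\sigma^i}=x^{q^{si}}$. A $\sigma$-polynomial over $\mathbb F_{q^n}$ is a polynomial $P(x)=\sum_{i=0}^{d}a_i x^{\sigma^i}$ with $a_i\in\mathbb F_{q^n}$; if $a_d\neq 0$, its $\sigma$-degree is $d$. It induces an $\mathbb F_q$-linear map $x\mapsto P(x)$ of $\mathbb F_{q^n}$. Let $\mathcal L_{n,\sigma}$ be the set of $\sigma$-polynomials modulo $x^{\sigma^n}-x$, whose elements are represented uniquely by the $\sigma$-polynomials that are zero or of $\sigma$-degree less than $n$, and are identified with the endomorphisms that these induce. A monic $\sigma$-polynomial of $\sigma$-degree $d<n$ is a $\sigma$-subspace polynomial of $\mathcal L_{n,\sigma}$ if the kernel of the induced map has dimension $d$ over $\mathbb F_q$. Let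 $$f(x)=x+\sum_{i=0}^{k-1}x^{\sigma^{tp_i}},\qquad g(x)=x^{\sigma^{tp_{k-1}}}+\sum_{i=0}^{k-1}x^{\sigma^{t(p_{k-1}-p_i)}}$$ (so $g=(\hat f)^{\sigma^{tp_{k-1}}}$, where $\hat f$ is the adjoint of $f$ with respect to the trace form $(x,y)\mapsto \mathrm{Tr}_{\mathbb F_{q^n}/\mathbb F_q}(xy)$). Then the sets $$\mathcal Q=\{\beta^{-\sigma^{tp_{k-1}}}f(\beta x):\beta\in\mathbb F_{q^n}^*\},\qquad \mathcal Q'=\{\beta^{-\sigma^{tp_{k-1}}}g(\beta x):\beta\in\mathbb F_{q^n}^*\}$$ consist of $\sigma$-subspace polynomials of $\mathcal L_{n,\sigma}$, and each of them has exactly $\dfrac{q^n-1}{q^t-1}$ elements, distinct elements of the same set inducing distinct endomorphisms of $\mathbb F_{q^n}$. -/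

import Mathlib

open Polynomial

namespace SigmaPoly

section Endo

variable (K : Type*) {L : Type*} [Field K] [Finite K] [Field L] [Algebra K L]

/-- `σ`-polynomials over `L`, where `σ = q ^ s` with `q = |K|`: the `L`-linear combinations
of the monomials `x ^ σ ^ i`, `i ≥ 0`. -/
def IsSigmaPoly (s : ℕ) (P : L[X]) : Prop :=
  P ∈ Submodule.span L (Set.range fun i : ℕ => (X : L[X]) ^ (Nat.card K ^ s) ^ i)

theorem pow_sigma_add (s i : ℕ) (x y : L) :
    (x + y) ^ (Nat.card K ^ s) ^ i
      = x ^ (Nat.card K ^ s) ^ i + y ^ (Nat.card K ^ s) ^ i := by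
  have := Fintype.ofFinite K
  rw [← pow_mul, Nat.card_eq_fintype_card]
  have h : ∀ z : L, ((FiniteField.frobeniusAlgHom K L) ^ (s * i)) z
      = z ^ Fintype.card K ^ (s * i) := by
    intro z
    simp [AlgHom.coe_pow, FiniteField.coe_frobeniusAlgHom, pow_iterate]
  rw [← h, map_add, h, h]

theorem pow_sigma_smul (s i : ℕ) (c : K) (x : L) :
    (c • x) ^ (Nat.card K ^ s) ^ i = c • x ^ (Nat.card K ^ s) ^ i := by
  have := Fintype.ofFinite K
  rw [_root_.smul_pow, ← pow_mul, Nat.card_eq_fintype_card, FiniteField.pow_card_pow]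

theorem IsSigmaPoly.eval_add {s : ℕ} {P : L[X]} (hP : IsSigmaPoly K s P) (x y : L) :
    P.eval (x + y) = P.eval x + P.eval y := by
  induction hP using Submodule.span_induction with
  | mem P h => obtain ⟨i, rfl⟩ := h; simp [pow_sigma_add]
  | zero => simp
  | add P Q _ _ h h' => simp only [Polynomial.eval_add, h, h']; ring
  | smul a P _ h => simp only [Polynomial.eval_smul, h, smul_add]

theorem IsSigmaPoly.eval_smul {s : ℕ} {P : L[X]} (hP : IsSigmaPoly K s P) (c : K) (x : L) :
    P.eval (c • x) = c • P.eval x := by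
  induction hP using Submodule.span_induction with
  | mem P h => obtain ⟨i, rfl⟩ := h; simp [pow_sigma_smul]
  | zero => simp
  | add P Q _ _ h h' => simp only [Polynomial.eval_add, h, h', smul_add]
  | smul a P _ h => simp only [Polynomial.eval_smul, h, smul_eq_mul, mul_smul_comm]

/-- The `K`-linear endomorphism `x ↦ P(x)` of `L` given by a `σ`-polynomial `P`. -/
def IsSigmaPoly.toEnd {s : ℕ} {P : L[X]} (hP : IsSigmaPoly K s P) : L →ₗ[K] L where
  toFun x := P.eval x
  map_add' := hP.eval_add K
  map_smul' := hP.eval_smul K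

/-- `P` is a `σ`-subspace polynomial of `𝓛_{n,σ}`, where `n = [L : K]`: a monic `σ`-polynomial,
reduced modulo `x ^ σ ^ n - x` (that is, of `σ`-degree `d < n`), whose kernel in `L` has
`K`-dimension equal to its `σ`-degree. -/
def IsSigmaSubspacePoly (s : ℕ) (P : L[X]) : Prop :=
  P.Monic ∧ ∃ hP : IsSigmaPoly K s P, ∃ d : ℕ,
    d < Module.finrank K L ∧ P.natDegree = (Nat.card K ^ s) ^ d ∧
      Module.finrank K (LinearMap.ker (hP.toEnd K)) = d

end Endo

/-- `p_i = 1 + q' + ⋯ + q' ^ i`. -/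
def geomSum (q' i : ℕ) : ℕ := ∑ j ∈ Finset.range (i + 1), q' ^ j

section Families

variable (L : Type*) [Field L]

/-- `f(x) = x + ∑_{i=0}^{k-1} x ^ σ ^ (t p_i)`. -/
noncomputable def genTrace (σ t q' k : ℕ) : L[X] :=
  X + ∑ i ∈ Finset.range k, X ^ σ ^ (t * geomSum q' i)

/-- `g(x) = x ^ σ ^ (t p_{k-1}) + ∑_{i=0}^{k-1} x ^ σ ^ (t (p_{k-1} - p_i))`, the
`σ ^ (t p_{k-1})`-th power of the adjoint of `f`. -/
noncomputable def genTraceAdj (σ t q' k : ℕ) : L[X] :=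
  X ^ σ ^ (t * geomSum q' (k - 1)) +
    ∑ i ∈ Finset.range k, X ^ σ ^ (t * (geomSum q' (k - 1) - geomSum q' i))

variable {L}

/-- The family `{β ^ (-σ ^ e) P(β x) : β ∈ L^*}`. -/
def scaledFamily (σ e : ℕ) (P : L[X]) : Set L[X] :=
  {R | ∃ β : L, β ≠ 0 ∧ R = C ((β ^ σ ^ e)⁻¹) * P.comp (C β * X)}

end Families

end SigmaPoly

/-! Write `A` for `tracePoly` or its reciprocal `tracePolyRev`. As an endomorphism, `f` or `g` is
`A(σ^t)`. Since `gcd(s, n) = 1`, `σ` has order `n` and minimal polynomial `x^n - 1`, of full degree,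
so `B(σ)` has kernel of dimension `deg B` for every divisor `B` of `x^n - 1`
(`finrank_ker_aeval_of_dvd`). In characteristic `p`, `x A^q' - A = x^{p_k} - 1` for `tracePoly`,
with a mirror identity for the reciprocal; hence `A(x^t)` divides `x^n - 1`. Scaling by `β` only
moves the kernel by `β⁻¹`.

For the count, `A` has nonzero coefficients in two adjacent degrees, so `β` and `γ` give the same
map iff `β/γ` is fixed by `σ^t`. The family is thus equinumerous with the image of `u ↦ u^(σ^t - 1)`
on the cyclic group `L^*`. -/

namespace SigmaPoly

/-! ### Kernels of polynomials in a cyclic endomorphism -/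

section Cyclic

variable {K V : Type*} [Field K] [AddCommGroup V] [Module K V] [FiniteDimensional K V]

/-- Over the principal ideal domain `K[X]`, some element of the module defined by `φ` has the
annihilator of the whole module. -/
theorem exists_aeval_apply_eq_zero_imp (φ : Module.End K V) :
    ∃ b : V, ∀ P : K[X], aeval φ P b = 0 → aeval φ P = 0 := by
  obtain ⟨x, hx⟩ := Module.exists_ker_toSpanSingleton_eq_annihilator K[X]
    (Module.AEval' φ)
  obtain ⟨b, rfl⟩ := (Module.AEval'.of φ).surjective x
  refine ⟨b, fun P hP => ?_⟩
  have h : P ∈ Module.annihilator K[X] (Module.AEval' φ) := by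
    rw [← hx, LinearMap.mem_ker, LinearMap.toSpanSingleton_apply, Module.AEval'.of,
      ← Module.AEval.of_aeval_smul, Module.End.smul_def, hP, map_zero]
  rwa [Module.AEval.annihilator_eq_ker_aeval] at h

/-- If the minimal polynomial of `φ` has degree `dim V`, then the kernel of `A(φ)` has dimension
at most `deg A`. -/
theorem finrank_ker_aeval_le {φ : Module.End K V}
    (hφ : (minpoly K φ).natDegree = Module.finrank K V) {A : K[X]} (hA : A ≠ 0) :
    Module.finrank K (LinearMap.ker (aeval φ A)) ≤ A.natDegree := by
  obtain ⟨b, hb⟩ := exists_aeval_apply_eq_zero_imp φ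
  rcases le_or_gt (Module.finrank K V) A.natDegree with h | h
  · exact (Submodule.finrank_le _).trans h
  set m := Module.finrank K V - A.natDegree with hm
  let ev : K[X] →ₗ[K] V := (LinearMap.applyₗ b) ∘ₗ (aeval φ : K[X] →ₐ[K] Module.End K V).toLinearMap
  have hev : ∀ P, ev P = aeval φ P b := fun P => rfl
  -- `P ↦ A(φ) P(φ) b` is injective in degrees below `m`: otherwise the minimal polynomial would
  -- divide a nonzero `A * P` of degree less than `dim V`. So `A(φ)` has rank at least `m`.
  let T : degreeLT K m →ₗ[K] LinearMap.range (aeval φ A) :=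
    ((aeval φ A).rangeRestrict ∘ₗ ev) ∘ₗ (degreeLT K m).subtype
  have hT : Function.Injective T := by
    rw [injective_iff_map_eq_zero]
    rintro ⟨P, hP⟩ h0
    have h1 : aeval φ (A * P) b = 0 := by
      simpa [T, hev, Subtype.ext_iff] using h0
    have h2 := minpoly.dvd K φ (hb _ h1)
    by_contra hne
    have hP0 : P ≠ 0 := fun h => hne (by simp [h])
    have h3 := natDegree_le_of_dvd h2 (mul_ne_zero hA hP0)
    rw [natDegree_mul hA hP0, hφ] at h3
    have h4 := (natDegree_lt_iff_degree_lt hP0).2 (mem_degreeLT.1 hP)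
    omega
  have h5 := LinearMap.finrank_le_finrank_of_injective hT
  rw [(degreeLTEquiv K m).finrank_eq, Module.finrank_fin_fun] at h5
  have h6 := LinearMap.finrank_range_add_finrank_ker (aeval φ A)
  omega

/-- With `A * B` the minimal polynomial, `range B(φ) ≤ ker A(φ)`, and the upper bounds for both
kernels add up to exactly `dim V`, which forces equality. -/
theorem finrank_ker_aeval_of_dvd {φ : Module.End K V}
    (hφ : (minpoly K φ).natDegree = Module.finrank K V) {A : K[X]} (hA : A ∣ minpoly K φ) :
    Module.finrank K (LinearMap.ker (aeval φ A)) = A.natDegree := by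
  obtain ⟨B, hB⟩ := hA
  have h0 : A * B ≠ 0 := hB ▸ minpoly.ne_zero (Algebra.IsIntegral.isIntegral φ)
  have hA := finrank_ker_aeval_le hφ (left_ne_zero_of_mul h0)
  have hB' := finrank_ker_aeval_le hφ (right_ne_zero_of_mul h0)
  have hle : LinearMap.range (aeval φ B) ≤ LinearMap.ker (aeval φ A) := by
    rw [LinearMap.range_le_ker_iff, ← Module.End.mul_eq_comp, ← map_mul, ← hB, minpoly.aeval]
  have h1 := Submodule.finrank_mono hle
  have h2 := LinearMap.finrank_range_add_finrank_ker (aeval φ B)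
  rw [hB, natDegree_mul (left_ne_zero_of_mul h0) (right_ne_zero_of_mul h0)] at hφ
  omega

end Cyclic

/-! ### The trace polynomial and its reciprocal divide `x^{p_k} - 1` -/

section Divisibility

variable {K : Type*} [Field K]

theorem geomSum_zero (q : ℕ) : geomSum q 0 = 1 := by simp [geomSum]

theorem geomSum_succ (q i : ℕ) : geomSum q (i + 1) = q * geomSum q i + 1 := by
  rw [geomSum, geomSum, geom_sum_succ]

theorem geomSum_strictMono {q : ℕ} (hq : 0 < q) : StrictMono (geomSum q) :=
  strictMono_nat_of_lt_succ fun i => by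
    rw [geomSum, geomSum, Finset.sum_range_succ _ (i + 1)]
    exact Nat.lt_add_of_pos_right (pow_pos hq _)

/-- The polynomial `1 + ∑_{i<k} x ^ p_i` of which `genTrace` is the linearization. -/
noncomputable def tracePoly (K : Type*) [Field K] (q k : ℕ) : K[X] :=
  1 + ∑ i ∈ Finset.range k, X ^ geomSum q i

/-- The reciprocal polynomial of `tracePoly`. -/
noncomputable def tracePolyRev (K : Type*) [Field K] (q k : ℕ) : K[X] :=
  X ^ geomSum q (k - 1) + ∑ i ∈ Finset.range k, X ^ (geomSum q (k - 1) - geomSum q i)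

/-- The `q'`-th power is additive and `p_{i+1} = q' p_i + 1`, so the left side shifts each exponent
`p_i` to `p_{i+1}`. -/
theorem X_mul_tracePoly_pow (p r k : ℕ) [Fact p.Prime] [CharP K p] :
    X * tracePoly K (p ^ r) k ^ p ^ r = tracePoly K (p ^ r) k + (X ^ geomSum (p ^ r) k - 1) := by
  have h : ∀ i, X * (X ^ geomSum (p ^ r) i) ^ p ^ r = (X : K[X]) ^ geomSum (p ^ r) (i + 1) := by
    intro i
    rw [geomSum_succ]
    ring
  have hs := Finset.sum_range_succ' (fun i => (X : K[X]) ^ geomSum (p ^ r) i) k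
  rw [Finset.sum_range_succ, geomSum_zero, pow_one] at hs
  rw [tracePoly, add_pow_char_pow, sum_pow_char_pow, mul_add, Finset.mul_sum]
  simp only [h, one_pow, mul_one]
  linear_combination -hs

theorem tracePoly_dvd (p r k : ℕ) [Fact p.Prime] [CharP K p] :
    tracePoly K (p ^ r) k ∣ X ^ geomSum (p ^ r) k - 1 := by
  rw [eq_sub_iff_add_eq'.2 (X_mul_tracePoly_pow (K := K) p r k).symm]
  exact dvd_sub (Dvd.dvd.mul_left (dvd_pow_self _ (pow_ne_zero _ (Fact.out : p.Prime).ne_zero)) _)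
    dvd_rfl

/-- Same shift on the exponents `p_k - p_i`. The index is a successor because for index `0` the
truncated `k - 1` makes `tracePolyRev` equal to `X`. -/
theorem tracePolyRev_dvd (p r k : ℕ) [hp : Fact p.Prime] [CharP K p] :
    tracePolyRev K (p ^ r) (k + 1) ∣ X ^ geomSum (p ^ r) (k + 1) - 1 := by
  have hm := (geomSum_strictMono (pow_pos hp.out.pos r)).monotone
  have hs := Finset.sum_range_succ'
    (fun i => (X : K[X]) ^ (geomSum (p ^ r) (k + 1) - geomSum (p ^ r) i)) (k + 1)
  rw [Finset.sum_range_succ, geomSum_zero, Nat.sub_self, pow_zero] at hs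
  have h1 : tracePolyRev K (p ^ r) (k + 1) ^ p ^ r = X ^ (geomSum (p ^ r) (k + 1) - 1) +
      ∑ i ∈ Finset.range (k + 1),
        X ^ (geomSum (p ^ r) (k + 1) - geomSum (p ^ r) (i + 1)) := by
    rw [tracePolyRev, add_pow_char_pow, sum_pow_char_pow, Nat.add_sub_cancel]
    congr 1
    · rw [← pow_mul, geomSum_succ, Nat.add_sub_cancel, mul_comm]
    · refine Finset.sum_congr rfl fun i _ => ?_
      rw [← pow_mul, geomSum_succ, geomSum_succ, Nat.add_sub_add_right, ← Nat.mul_sub, mul_comm]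
  have h2 : X ^ (geomSum (p ^ r) (k + 1) - geomSum (p ^ r) k) * tracePolyRev K (p ^ r) (k + 1) =
      X ^ geomSum (p ^ r) (k + 1) + ∑ i ∈ Finset.range (k + 1),
        X ^ (geomSum (p ^ r) (k + 1) - geomSum (p ^ r) i) := by
    rw [tracePolyRev, mul_add, Finset.mul_sum, Nat.add_sub_cancel, ← pow_add,
      Nat.sub_add_cancel (hm k.le_succ)]
    congr 1
    refine Finset.sum_congr rfl fun i hi => ?_
    have := hm (Nat.lt_succ_iff.1 (Finset.mem_range.1 hi))
    have : geomSum (p ^ r) k ≤ geomSum (p ^ r) (k + 1) := hm k.le_succ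
    rw [← pow_add]
    congr 1
    omega
  have h3 : (X : K[X]) ^ geomSum (p ^ r) (k + 1) - 1 =
      X ^ (geomSum (p ^ r) (k + 1) - geomSum (p ^ r) k) * tracePolyRev K (p ^ r) (k + 1) -
        tracePolyRev K (p ^ r) (k + 1) ^ p ^ r := by
    rw [h1, h2]
    linear_combination -hs
  rw [h3]
  exact dvd_sub (dvd_mul_left _ _) (dvd_pow_self _ (pow_ne_zero _ hp.out.ne_zero))

theorem degree_sum_X_pow_lt {ι : Type*} (s : Finset ι) (e : ι → ℕ) {m : ℕ}
    (h : ∀ i ∈ s, e i < m) : (∑ i ∈ s, (X : K[X]) ^ e i).degree < m :=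
  mem_degreeLT.1 <| Submodule.sum_mem _ fun i hi => mem_degreeLT.2 <| by
    rw [degree_X_pow]; exact_mod_cast h i hi

theorem natDegree_X_pow_add_of_degree_lt {R : Type*} [Semiring R] [Nontrivial R] {A : R[X]}
    {m : ℕ} (h : A.degree < m) : (X ^ m + A).natDegree = m := by
  rw [natDegree_add_eq_left_of_degree_lt (by rwa [degree_X_pow]), natDegree_X_pow]

/-- The adjacent nonzero coefficients serve to separate scalings by different `β`. -/
theorem tracePoly_spec {q : ℕ} (hq : 0 < q) (k : ℕ) :
    (tracePoly K q (k + 1)).Monic ∧ (tracePoly K q (k + 1)).natDegree = geomSum q k ∧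
      (tracePoly K q (k + 1)).coeff 0 = 1 ∧ (tracePoly K q (k + 1)).coeff 1 = 1 := by
  have hm := geomSum_strictMono hq
  have h0 : ∀ i, 0 < geomSum q i := fun i =>
    Nat.lt_of_lt_of_le (by simp [geomSum_zero]) (hm.monotone i.zero_le)
  have hd : (1 + ∑ i ∈ Finset.range k, (X : K[X]) ^ geomSum q i).degree < geomSum q k := by
    refine (degree_add_le _ _).trans_lt (max_lt ?_ ?_)
    · rw [degree_one]; exact_mod_cast h0 k
    · exact degree_sum_X_pow_lt _ _ fun i hi => hm (Finset.mem_range.1 hi)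
  have he : tracePoly K q (k + 1) =
      X ^ geomSum q k + (1 + ∑ i ∈ Finset.range k, (X : K[X]) ^ geomSum q i) := by
    rw [tracePoly, Finset.sum_range_succ]; ring
  have h1 : ∀ i, 1 = geomSum q i ↔ i = 0 := fun i => by
    rw [← geomSum_zero q, hm.injective.eq_iff, eq_comm]
  refine ⟨he ▸ monic_X_pow_add hd, he ▸ natDegree_X_pow_add_of_degree_lt hd, ?_, ?_⟩
  · simp [tracePoly, coeff_X_pow, (h0 _).ne]
  · simp [tracePoly, coeff_X_pow, h1, coeff_one]

theorem tracePolyRev_spec {q : ℕ} (hq : 0 < q) (k : ℕ) :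
    (tracePolyRev K q (k + 1)).Monic ∧ (tracePolyRev K q (k + 1)).natDegree = geomSum q k ∧
      (tracePolyRev K q (k + 1)).coeff (geomSum q k - 1) = 1 ∧
      (tracePolyRev K q (k + 1)).coeff (geomSum q k - 1 + 1) = 1 := by
  have hm := geomSum_strictMono hq
  have h0 : ∀ i, 0 < geomSum q i := fun i =>
    Nat.lt_of_lt_of_le (by simp [geomSum_zero]) (hm.monotone i.zero_le)
  have hd : (∑ i ∈ Finset.range (k + 1), (X : K[X]) ^ (geomSum q k - geomSum q i)).degree
      < geomSum q k :=
    degree_sum_X_pow_lt _ _ fun i _ => Nat.sub_lt (h0 k) (h0 i)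
  have h1 : ∀ i ∈ Finset.range (k + 1), geomSum q k - 1 = geomSum q k - geomSum q i ↔ i = 0 := by
    intro i hi
    rw [← hm.injective.eq_iff (b := 0), geomSum_zero]
    have := hm.monotone (Nat.lt_succ_iff.1 (Finset.mem_range.1 hi))
    have := h0 i
    omega
  have hM := monic_X_pow_add hd
  have hN := natDegree_X_pow_add_of_degree_lt hd
  refine ⟨hM, hN, ?_, ?_⟩
  · have hlt := (h0 k).ne'
    rw [tracePolyRev, coeff_add, finsetSum_coeff, Nat.add_sub_cancel,
      Finset.sum_congr rfl (fun i hi => by rw [coeff_X_pow, if_congr (h1 i hi) rfl rfl])]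
    simp [coeff_X_pow]
    omega
  · rw [Nat.sub_add_cancel (h0 k)]
    exact hN ▸ hM.coeff_natDegree

end Divisibility

/-! ### From ordinary polynomials to `σ`-polynomials -/

section Linearize

variable {K L : Type*} [Field K] [Field L] [Algebra K L]

/-- The `K`-linear map `∑ aᵢ x ^ i ↦ ∑ aᵢ x ^ σ ^ i`. -/
noncomputable def linearize (K L : Type*) [Field K] [Field L] [Algebra K L] (σ : ℕ) :
    K[X] →ₗ[K] L[X] :=
  Polynomial.lsum fun i => LinearMap.toSpanSingleton K L[X] (X ^ σ ^ i)

theorem linearize_apply (σ : ℕ) (A : K[X]) :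
    linearize K L σ A = ∑ i ∈ A.support, C (algebraMap K L (A.coeff i)) * X ^ σ ^ i := by
  rw [linearize, lsum_apply, Polynomial.sum]
  simp [Algebra.smul_def, Polynomial.algebraMap_apply]

@[simp]
theorem linearize_X_pow (σ i : ℕ) : linearize K L σ (X ^ i) = X ^ σ ^ i := by
  simp [linearize_apply, support_X_pow]

theorem linearize_monic_natDegree {σ : ℕ} (hσ : 1 < σ) {A : K[X]} (hA : A.Monic) :
    (linearize K L σ A).Monic ∧ (linearize K L σ A).natDegree = σ ^ A.natDegree := by
  have h : linearize K L σ A = X ^ σ ^ A.natDegree + linearize K L σ A.eraseLead := by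
    conv_lhs => rw [← A.eraseLead_add_monomial_natDegree_leadingCoeff]
    rw [hA.leadingCoeff, monomial_one_right_eq_X_pow, map_add, linearize_X_pow, add_comm]
  have hd : (linearize K L σ A.eraseLead).degree < ((σ ^ A.natDegree : ℕ) : WithBot ℕ) := by
    rw [linearize_apply]
    refine mem_degreeLT.1 <| Submodule.sum_mem _ fun i hi => mem_degreeLT.2 ?_
    refine (degree_C_mul_X_pow_le _ _).trans_lt ?_
    have hi' : i < A.natDegree :=
      lt_of_le_of_ne (le_natDegree_of_mem_supp _ (Finset.mem_of_mem_erase (eraseLead_support A ▸ hi)))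
        (ne_natDegree_of_mem_eraseLead_support hi)
    exact_mod_cast Nat.pow_lt_pow_right hσ hi'
  rw [h]
  exact ⟨monic_X_pow_add hd, natDegree_X_pow_add_of_degree_lt hd⟩

/-- The polynomial `β ^ (-σ ^ e) P(β x)` where `P` is the linearization of `A`. -/
noncomputable def scaled (σ e : ℕ) (A : K[X]) (β : L) : L[X] :=
  C ((β ^ σ ^ e)⁻¹) * (linearize K L σ A).comp (C β * X)

theorem scaled_eq_sum (σ e : ℕ) (A : K[X]) (β : L) :
    scaled σ e A β = ∑ i ∈ A.support,
      C (algebraMap K L (A.coeff i) * ((β ^ σ ^ e)⁻¹ * β ^ σ ^ i)) * X ^ σ ^ i := by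
  rw [scaled, linearize_apply, Polynomial.sum_comp, Finset.mul_sum]
  refine Finset.sum_congr rfl fun i _ => ?_
  simp only [mul_comp, C_comp, pow_comp, X_comp, mul_pow, C_mul, C_pow]
  ring

theorem scaled_monic {σ : ℕ} (hσ : 1 < σ) {A : K[X]} (hA : A.Monic) {β : L} (hβ : β ≠ 0) :
    (scaled σ A.natDegree A β).Monic ∧ (scaled σ A.natDegree A β).natDegree = σ ^ A.natDegree := by
  obtain ⟨hm, hd⟩ := linearize_monic_natDegree (L := L) hσ hA
  have hX : (C β * X).natDegree = 1 := natDegree_C_mul_X β hβ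
  constructor
  · rw [Monic, scaled, leadingCoeff_mul, leadingCoeff_C, leadingCoeff_comp (by simp [hX]),
      hm.leadingCoeff, hd, leadingCoeff_C_mul_X, one_mul, inv_mul_cancel₀ (pow_ne_zero _ hβ)]
  · rw [scaled, natDegree_C_mul (inv_ne_zero (pow_ne_zero _ hβ)), natDegree_comp, hX, hd, mul_one]

theorem isSigmaPoly_scaled [Finite K] (s e : ℕ) (A : K[X]) (β : L) :
    IsSigmaPoly K s (scaled (Nat.card K ^ s) e A β) := by
  rw [scaled_eq_sum]
  refine Submodule.sum_mem _ fun i _ => ?_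
  rw [← smul_eq_C_mul]
  exact Submodule.smul_mem _ _ (Submodule.subset_span ⟨i, rfl⟩)

end Linearize

/-! ### The automorphism `σ`, kernels and counting -/

section Frobenius

variable (K L : Type*) [Field K] [Finite K] [Field L] [Algebra K L] [FiniteDimensional K L]

/-- The automorphism `x ↦ x ^ q ^ s` of `L` over `K`, where `q = |K|`. -/
noncomputable def sigmaAut (s : ℕ) : Gal(L/K) :=
  letI := Fintype.ofFinite K
  FiniteField.frobeniusAlgEquivOfAlgebraic K L ^ s

variable {K L}

theorem sigmaAut_pow_apply (s i : ℕ) (x : L) :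
    (sigmaAut K L s ^ i) x = x ^ (Nat.card K ^ s) ^ i := by
  have := Fintype.ofFinite K
  rw [sigmaAut, ← pow_mul, AlgEquiv.coe_pow, FiniteField.coe_frobeniusAlgEquivOfAlgebraic_iterate,
    ← pow_mul, Nat.card_eq_fintype_card]
  simp only [Fintype.card_eq_nat_card]

theorem orderOf_sigmaAut {s : ℕ} (hs : s.Coprime (Module.finrank K L)) :
    orderOf (sigmaAut K L s) = Module.finrank K L := by
  have := Fintype.ofFinite K
  have : Finite L := Module.finite_of_finite K
  rw [sigmaAut, Nat.Coprime.orderOf_pow] <;>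
    rw [FiniteField.orderOf_frobeniusAlgEquivOfAlgebraic]
  exact hs.symm

theorem minpoly_sigmaAut {s : ℕ} (hs : s.Coprime (Module.finrank K L)) :
    minpoly K (sigmaAut K L s).toLinearMap = X ^ Module.finrank K L - 1 := by
  have h := orderOf_sigmaAut hs
  rw [minpoly_algEquiv_toLinearMap _ (orderOf_pos_iff.1 (h ▸ Module.finrank_pos)), h, C_1]

theorem eval_linearize (s : ℕ) (A : K[X]) (x : L) :
    (linearize K L (Nat.card K ^ s) A).eval x =
      aeval (R := K) (A := Module.End K L) (sigmaAut K L s).toLinearMap A x := by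
  have h : ∀ i, ((sigmaAut K L s).toLinearMap ^ i : Module.End K L) x =
      x ^ (Nat.card K ^ s) ^ i := fun i => by
    rw [← sigmaAut_pow_apply, Module.End.coe_pow, AlgEquiv.coe_pow]; rfl
  rw [linearize_apply, aeval_eq_sum_range' (Nat.lt_succ_self _), eval_finsetSum,
    LinearMap.sum_apply]
  refine (Finset.sum_subset supp_subset_range_natDegree_succ ?_).trans
    (Finset.sum_congr rfl fun i _ => ?_)
  · intro i _ hi
    simp [notMem_support_iff.1 hi]
  · simp [h, Algebra.smul_def]

theorem isSigmaSubspacePoly_scaled {s : ℕ} (hs : s.Coprime (Module.finrank K L)) (hs0 : 0 < s)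
    {A : K[X]} (hA : A.Monic) (hdvd : A ∣ X ^ Module.finrank K L - 1)
    (hlt : A.natDegree < Module.finrank K L) {β : L} (hβ : β ≠ 0) :
    IsSigmaSubspacePoly K s (scaled (Nat.card K ^ s) A.natDegree A β) := by
  have hσ : 1 < Nat.card K ^ s := Nat.one_lt_pow hs0.ne' Finite.one_lt_card
  obtain ⟨hm, hd⟩ := scaled_monic hσ hA hβ
  refine ⟨hm, isSigmaPoly_scaled s _ A β, A.natDegree, hlt, hd, ?_⟩
  have hmin := minpoly_sigmaAut (L := L) hs
  refine Eq.trans ?_ (finrank_ker_aeval_of_dvd (φ := (sigmaAut K L s).toLinearMap) ?_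
    (hmin ▸ hdvd))
  · let e : L ≃ₗ[K] L := LinearEquiv.smulOfNeZero L L β hβ |>.restrictScalars K
    have hk : LinearMap.ker ((isSigmaPoly_scaled s A.natDegree A β).toEnd K) =
        (LinearMap.ker (aeval (R := K) (A := Module.End K L)
          (sigmaAut K L s).toLinearMap A)).comap (e : L →ₗ[K] L) := by
      ext x
      rw [Submodule.mem_comap, LinearMap.mem_ker, LinearMap.mem_ker, ← eval_linearize]
      change eval x (scaled _ _ A β) = 0 ↔ eval (β * x) _ = 0
      simp [scaled, hβ]
    refine (LinearEquiv.ofEq _ _ hk).finrank_eq.trans ?_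
    rw [Submodule.comap_equiv_eq_map_symm]
    exact LinearEquiv.finrank_map_eq e.symm _
  · rw [hmin, ← C_1, natDegree_X_pow_sub_C]

/-- Dedekind's independence of characters, applied to the `n` distinct powers of `σ`. -/
theorem linearIndependent_pow_sigma {s : ℕ} (hs : s.Coprime (Module.finrank K L)) :
    LinearIndependent L fun (i : Fin (Module.finrank K L)) (x : L) =>
      x ^ (Nat.card K ^ s) ^ (i : ℕ) := by
  have h : Function.Injective fun i : Fin (Module.finrank K L) =>
      ((sigmaAut K L s ^ (i : ℕ) : Gal(L/K)) : L →* L) := by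
    intro i j hij
    refine Fin.ext (pow_injOn_Iio_orderOf (x := sigmaAut K L s) ?_ ?_ ?_)
    · simp [orderOf_sigmaAut hs]
    · simp [orderOf_sigmaAut hs]
    · exact AlgEquiv.ext fun x => DFunLike.congr_fun hij x
  have h2 := (linearIndependent_monoidHom L L).comp _ h
  have h3 : (fun (i : Fin (Module.finrank K L)) (x : L) => x ^ (Nat.card K ^ s) ^ (i : ℕ)) =
      (fun f : L →* L => (f : L → L)) ∘ fun i : Fin (Module.finrank K L) =>
        ((sigmaAut K L s ^ (i : ℕ) : Gal(L/K)) : L →* L) := by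
    ext i x
    exact (sigmaAut_pow_apply s i x).symm
  rw [h3]
  exact h2

theorem coeff_eq_of_eval_scaled_eq {s : ℕ} (hs : s.Coprime (Module.finrank K L)) {e : ℕ} {A : K[X]}
    (hlt : A.natDegree < Module.finrank K L) {β γ : L}
    (h : ∀ x, (scaled (Nat.card K ^ s) e A β).eval x = (scaled (Nat.card K ^ s) e A γ).eval x)
    {i : ℕ} (hi : A.coeff i ≠ 0) :
    (β ^ (Nat.card K ^ s) ^ e)⁻¹ * β ^ (Nat.card K ^ s) ^ i =
      (γ ^ (Nat.card K ^ s) ^ e)⁻¹ * γ ^ (Nat.card K ^ s) ^ i := by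
  have hsum : ∀ (δ x : L), (scaled (Nat.card K ^ s) e A δ).eval x =
      ∑ i : Fin (Module.finrank K L), (algebraMap K L (A.coeff i) *
        ((δ ^ (Nat.card K ^ s) ^ e)⁻¹ * δ ^ (Nat.card K ^ s) ^ (i : ℕ))) *
          x ^ (Nat.card K ^ s) ^ (i : ℕ) := by
    intro δ x
    rw [scaled_eq_sum, eval_finsetSum, Fin.sum_univ_eq_sum_range (fun i =>
      (algebraMap K L (A.coeff i) * ((δ ^ (Nat.card K ^ s) ^ e)⁻¹ * δ ^ (Nat.card K ^ s) ^ i)) *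
        x ^ (Nat.card K ^ s) ^ i)]
    refine (Finset.sum_congr rfl fun i _ => ?_).trans
      (Finset.sum_subset (supp_subset_range hlt) fun i _ hi => ?_)
    · simp
    · simp [notMem_support_iff.1 hi]
  have hli := Fintype.linearIndependent_iff.1 (linearIndependent_pow_sigma (L := L) hs)
    (fun i => algebraMap K L (A.coeff i) *
        ((β ^ (Nat.card K ^ s) ^ e)⁻¹ * β ^ (Nat.card K ^ s) ^ (i : ℕ)) -
      algebraMap K L (A.coeff i) *
        ((γ ^ (Nat.card K ^ s) ^ e)⁻¹ * γ ^ (Nat.card K ^ s) ^ (i : ℕ))) (by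
      ext x
      have := h x
      rw [hsum, hsum, ← sub_eq_zero, ← Finset.sum_sub_distrib] at this
      simpa [sub_mul] using this)
    ⟨i, (le_natDegree_of_ne_zero hi).trans_lt hlt⟩
  rw [← mul_sub, mul_eq_zero, sub_eq_zero] at hli
  exact hli.resolve_left (by simpa using hi)

theorem pow_sigma_pow_inj (s j : ℕ) {x y : L}
    (h : x ^ (Nat.card K ^ s) ^ j = y ^ (Nat.card K ^ s) ^ j) : x = y := by
  rw [← sigmaAut_pow_apply, ← sigmaAut_pow_apply] at h
  exact (sigmaAut K L s ^ j).injective h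

theorem pow_sub_one_eq_iff {m : ℕ} (hm : 0 < m) {x y : L} (hx : x ≠ 0) (hy : y ≠ 0) :
    x ^ (m - 1) = y ^ (m - 1) ↔ (x / y) ^ m = x / y := by
  obtain ⟨m, rfl⟩ := Nat.exists_eq_succ_of_ne_zero hm.ne'
  rw [Nat.succ_sub_one, pow_succ, mul_eq_right₀ (div_ne_zero hx hy), div_pow,
    div_eq_one_iff_eq (pow_ne_zero _ hy)]

theorem pow_pow_mul_eq_self {u : L} {m t : ℕ} (h : u ^ m ^ t = u) (i : ℕ) : u ^ m ^ (t * i) = u := by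
  induction i with
  | zero => simp
  | succ i ih => rw [mul_add, mul_one, pow_add, pow_mul, ih, h]

/-- In a cyclic group of order `q^n - 1` the image has index `gcd(q^(st) - 1, q^n - 1) = q^gcd(st,
n) - 1 = q^t - 1`. -/
theorem card_range_units_pow {t : ℕ} (s : ℕ) (hs : s.Coprime (Module.finrank K L))
    (ht : t ∣ Module.finrank K L) :
    (Set.range fun u : Lˣ => u ^ ((Nat.card K ^ s) ^ t - 1)).ncard =
      (Nat.card K ^ Module.finrank K L - 1) / (Nat.card K ^ t - 1) := by
  have : Finite L := Module.finite_of_finite K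
  have h := IsCyclic.card_powMonoidHom_range Lˣ ((Nat.card K ^ s) ^ t - 1)
  rw [Nat.card_units, Module.natCard_eq_pow_finrank (K := K) (V := L), ← pow_mul,
    Nat.pow_sub_one_gcd_pow_sub_one, hs.gcd_mul_left_cancel_right, Nat.gcd_eq_right ht] at h
  rw [pow_mul] at h
  exact h

/-- Common core of both families, used with `N = p_k`. -/
theorem scaledFamily_linearize {s t : ℕ} (hs : s.Coprime (Module.finrank K L)) (hs0 : 0 < s)
    {A : K[X]} {N : ℕ} (hN : t * N = Module.finrank K L)
    (hA : A.Monic) (hdvd : A ∣ X ^ N - 1)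
    (hlt : A.natDegree < N) {j : ℕ} (hj : A.coeff j ≠ 0) (hj' : A.coeff (j + 1) ≠ 0)
    {Q : Set L[X]} (hQ : Q = scaledFamily (Nat.card K ^ s) (t * A.natDegree)
      (linearize K L (Nat.card K ^ s) (expand K t A))) :
    (∀ P ∈ Q, IsSigmaSubspacePoly K s P) ∧
      (Q.ncard : ℚ) = ((Nat.card K : ℚ) ^ Module.finrank K L - 1) / ((Nat.card K : ℚ) ^ t - 1) ∧
      Set.InjOn (fun (P : L[X]) (x : L) => P.eval x) Q := by
  set σ := Nat.card K ^ s with hσ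
  have hn : 0 < Module.finrank K L := Module.finrank_pos
  have ht : 0 < t := Nat.pos_of_ne_zero (by rintro rfl; simp at hN; omega)
  have hq : 1 < Nat.card K := Finite.one_lt_card
  have hE : (expand K t A).natDegree = t * A.natDegree := by rw [natDegree_expand, mul_comm]
  have hEm : (expand K t A).Monic := hA.expand ht
  have hEd : expand K t A ∣ X ^ Module.finrank K L - 1 := by
    have := map_dvd (expand K t) hdvd
    simpa [← pow_mul, hN] using this
  have hEl : (expand K t A).natDegree < Module.finrank K L := by
    rw [hE, ← hN]
    exact Nat.mul_lt_mul_of_pos_left hlt ht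
  let F : Lˣ → L[X] := fun u => scaled σ (t * A.natDegree) (expand K t A) (u : L)
  have hQF : Q = Set.range F := by
    rw [hQ]
    ext R
    constructor
    · rintro ⟨β, hβ, rfl⟩
      exact ⟨Units.mk0 β hβ, rfl⟩
    · rintro ⟨u, rfl⟩
      exact ⟨u, u.ne_zero, rfl⟩
  have hpow : ∀ u v : Lˣ, u ^ (σ ^ t - 1) = v ^ (σ ^ t - 1) ↔
      ((u : L) / v) ^ σ ^ t = (u : L) / v := fun u v => by
    rw [← pow_sub_one_eq_iff (pow_pos (pow_pos hq.le _) _) u.ne_zero v.ne_zero, Units.ext_iff]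
    simp only [Units.val_pow_eq_pow_val, hσ]
  -- Only exponents `σ^(t i)` occur, and all of them fix `u / v`.
  have hpoly : ∀ u v : Lˣ, u ^ (σ ^ t - 1) = v ^ (σ ^ t - 1) → F u = F v := by
    intro u v h
    have h2 : ∀ i, (u : L) ^ σ ^ (t * i) = u / v * (v : L) ^ σ ^ (t * i) := fun i => by
      have := pow_pow_mul_eq_self ((hpow u v).1 h) i
      rwa [div_pow, div_eq_iff (pow_ne_zero _ v.ne_zero)] at this
    simp only [F, scaled_eq_sum]
    refine Finset.sum_congr rfl fun i hi => ?_
    rw [mem_support_iff, coeff_expand ht, ne_eq, ite_eq_right_iff, Classical.not_imp] at hi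
    obtain ⟨⟨i, rfl⟩, -⟩ := hi
    rw [h2, h2]
    congr 3
    have hu := u.ne_zero
    have hv := v.ne_zero
    field_simp
  have heval : ∀ u v : Lˣ, (∀ x, (F u).eval x = (F v).eval x) →
      u ^ (σ ^ t - 1) = v ^ (σ ^ t - 1) := by
    intro u v h
    have h0 := coeff_eq_of_eval_scaled_eq hs hEl h (i := j * t) (by rwa [coeff_expand_mul ht])
    have h1 := coeff_eq_of_eval_scaled_eq hs hEl h (i := (j + 1) * t)
      (by rwa [coeff_expand_mul ht])
    have hdiv : ∀ a b : ℕ, ((u : L) ^ a)⁻¹ * (u : L) ^ b = ((v : L) ^ a)⁻¹ * (v : L) ^ b →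
        ((u : L) / v) ^ b = ((u : L) / v) ^ a := fun a b hab => by
      have hu := u.ne_zero
      have hv := v.ne_zero
      rw [div_pow, div_pow, div_eq_div_iff (pow_ne_zero _ hv) (pow_ne_zero _ hv)]
      field_simp at hab
      exact hab
    -- With `w = u / v`, the coefficients at `j` and `j + 1` show that `w^σ^(jt)` and `w^σ^((j+1)t)`
    -- both equal `w^σ^e`, where `e = t * A.natDegree`; then `σ^(jt)` is cancelled.
    rw [hpow]
    apply pow_sigma_pow_inj (K := K) s (j * t)
    rw [← pow_mul, ← hσ, ← pow_add, hdiv _ _ h0, ← hdiv _ _ h1]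
    congr 2
    ring
  refine ⟨?_, ?_, ?_⟩
  · rw [hQF]
    rintro _ ⟨u, rfl⟩
    have := isSigmaSubspacePoly_scaled hs hs0 hEm hEd hEl u.ne_zero
    rwa [hE] at this
  -- `F` and the power map have the same fibres, hence equinumerous images.
  · have hker : Setoid.ker F = Setoid.ker fun u : Lˣ => u ^ (σ ^ t - 1) :=
      Setoid.ext fun u v => ⟨fun h => heval u v fun x => congrArg (eval x) h, hpoly u v⟩
    have hcard : Q.ncard = (Nat.card K ^ Module.finrank K L - 1) / (Nat.card K ^ t - 1) := by
      rw [← card_range_units_pow s hs ⟨N, hN.symm⟩, hQF, ← Nat.card_coe_set_eq,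
        ← Nat.card_coe_set_eq, ← Nat.card_congr (Setoid.quotientKerEquivRange F), hker,
        Nat.card_congr (Setoid.quotientKerEquivRange fun u : Lˣ => u ^ (σ ^ t - 1))]
    have h1 : 1 < Nat.card K ^ t := Nat.one_lt_pow ht.ne' hq
    rw [hcard, Nat.cast_div, Nat.cast_sub (Nat.one_le_pow _ _ hq.le), Nat.cast_sub h1.le]
    · simp
    · exact Nat.pow_sub_one_dvd_pow_sub_one _ ⟨N, hN.symm⟩
    · exact_mod_cast (Nat.sub_pos_of_lt h1).ne'
  · rw [hQF]
    rintro _ ⟨u, rfl⟩ _ ⟨v, rfl⟩ h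
    exact hpoly u v (heval u v fun x => congrFun h x)

end Frobenius

/-! ### Identification of `f` and `g`, and conclusion -/

section Families

variable {K L : Type*} [Field K] [Field L] [Algebra K L]

theorem linearize_expand_tracePoly (σ t q k : ℕ) :
    linearize K L σ (expand K t (tracePoly K q k)) = genTrace L σ t q k := by
  have h : linearize K L σ 1 = X := by simpa using linearize_X_pow (K := K) (L := L) σ 0
  simp [tracePoly, genTrace, h, ← pow_mul]

theorem linearize_expand_tracePolyRev (σ t q k : ℕ) :
    linearize K L σ (expand K t (tracePolyRev K q k)) = genTraceAdj L σ t q k := by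
  simp [tracePolyRev, genTraceAdj, ← pow_mul]

end Families

end SigmaPoly

theorem mainTheorem3 {K L : Type*} [Field K] [Finite K] [Field L] [Algebra K L]
    (p q a r k t s n : ℕ) (hp : p.Prime) (ha : 0 < a) (hq : q = p ^ a)
    (hk : 0 < k) (ht : 0 < t) (hn : n = t * SigmaPoly.geomSum (p ^ r) k)
    (hs : 0 < s) (hsn : Nat.Coprime s n)
    (hK : Nat.card K = q) (hL : Module.finrank K L = n)
    (Q Q' : Set (Polynomial L))
    (hQ : Q = SigmaPoly.scaledFamily (q ^ s) (t * SigmaPoly.geomSum (p ^ r) (k - 1))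
      (SigmaPoly.genTrace L (q ^ s) t (p ^ r) k))
    (hQ' : Q' = SigmaPoly.scaledFamily (q ^ s) (t * SigmaPoly.geomSum (p ^ r) (k - 1))
      (SigmaPoly.genTraceAdj L (q ^ s) t (p ^ r) k)) :
    ((∀ P ∈ Q, SigmaPoly.IsSigmaSubspacePoly K s P) ∧
      (Q.ncard : ℚ) = ((q : ℚ) ^ n - 1) / ((q : ℚ) ^ t - 1) ∧
      Set.InjOn (fun (P : Polynomial L) (x : L) => P.eval x) Q) ∧
    ((∀ P ∈ Q', SigmaPoly.IsSigmaSubspacePoly K s P) ∧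
      (Q'.ncard : ℚ) = ((q : ℚ) ^ n - 1) / ((q : ℚ) ^ t - 1) ∧
      Set.InjOn (fun (P : Polynomial L) (x : L) => P.eval x) Q') := by
  obtain ⟨k, rfl⟩ := Nat.exists_eq_succ_of_ne_zero hk.ne'
  have : Fact p.Prime := ⟨hp⟩
  have hq0 : 0 < p ^ r := pow_pos hp.pos r
  have hmono := SigmaPoly.geomSum_strictMono hq0
  have hchar : CharP K p := by
    have := Fintype.ofFinite K
    exact charP_of_card_eq_prime_pow (f := a) (by rw [Fintype.card_eq_nat_card, hK, hq])
  -- `finrank` is `0` in infinite dimension, so `n > 0` yields finite-dimensionality.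
  have hnpos : 0 < Module.finrank K L := by
    rw [hL, hn]
    exact Nat.mul_pos ht ((Nat.zero_le _).trans_lt (hmono k.lt_succ_self))
  have : FiniteDimensional K L := Module.finite_of_finrank_pos hnpos
  subst hK hL
  rw [Nat.succ_sub_one] at hQ hQ'
  obtain ⟨h1, h2, h3, h4⟩ := SigmaPoly.tracePoly_spec (K := K) hq0 k
  obtain ⟨g1, g2, g3, g4⟩ := SigmaPoly.tracePolyRev_spec (K := K) hq0 k
  refine ⟨SigmaPoly.scaledFamily_linearize hsn hs hn.symm h1 (SigmaPoly.tracePoly_dvd p r _)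
      (h2 ▸ hmono k.lt_succ_self) (h3 ▸ one_ne_zero) (h4 ▸ one_ne_zero) ?_,
    SigmaPoly.scaledFamily_linearize hsn hs hn.symm g1 (SigmaPoly.tracePolyRev_dvd p r _)
      (g2 ▸ hmono k.lt_succ_self) (g3 ▸ one_ne_zero) (g4 ▸ one_ne_zero) ?_⟩
  · rw [hQ, h2, SigmaPoly.linearize_expand_tracePoly]
  · rw [hQ', g2, SigmaPoly.linearize_expand_tracePolyRev]
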